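/- Let $A_1,\dots,A_m\in\mathbb R^{n\times n}$ and $a_1,\dots,a_m\in\mathbb R^n$, and let $f=(f_1,\dots,f_m):\mathbb R^n\to\mathbb R^m$ be the quadratic map with $f_i(x)=\tfrac12x^TA_ix+a_i^Tx$. Put $A=[a_1~\dots~a_m]\in\mathbb R^{n\times m}$, $$\nu=\sigma_{\min}(A)=\sqrt{\lambda_{\min}(A^TA)},\qquad L_{\rm new}=\sqrt{\lambda_{\max}\Big(\sum_{i=1}^mA_i^TA_i\Big)},\qquad \epsilon^*_{\rm new}=\frac{\nu}{2L_{\rm new}},$$ where $\lambda_{\min}$ and $\lambda_{\max}$ denote the smallest and the largest eigenvalue of a symmetric matrix, and where $\epsilon^*_{\rm new}=+\infty$ if $L_{\rm new}=0<\nu$ and $\epsilon^*_{\rm new}=0$ if $L_{\rm new}=\nu=0$. Let $\|\cdot\|$ be the Euclidean norm. Then for every real $\epsilon$ with $0<\epsilon<\epsilon^*_{\rm new}$ and every $a\in\mathbb R^n$ with $\|a\|<2(\epsilon^*_{\rm new}-\epsilon)$, the image $$F_m(\epsilon,a)=\{f(x):x\in\mathbb R^n,\ \|x-a\|\le\epsilon\}$$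 is a convex subset of $\mathbb R^m$. -/

import Mathlib

open scoped Matrix ENNReal

noncomputable section

namespace QuadMap

/-- The largest real eigenvalue of a real square matrix (used for symmetric matrices only,
where the spectrum is a finite set of reals, nonempty in positive dimension). -/
def lambdaMax {k : ℕ} (M : Matrix (Fin k) (Fin k) ℝ) : ℝ := sSup (spectrum ℝ M)

/-- The smallest real eigenvalue of a real square matrix (used for symmetric matrices only). -/
def lambdaMin {k : ℕ} (M : Matrix (Fin k) (Fin k) ℝ) : ℝ := sInf (spectrum ℝ M)

/-- The smallest singular value `√(λ_min(BᵀB))` of an `n × m` matrix `B`. -/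
def sigmaMin {n m : ℕ} (B : Matrix (Fin n) (Fin m) ℝ) : ℝ := √(lambdaMin (Bᵀ * B))

/-- The quadratic map `f = (f_1, …, f_m)` with `f_i(x) = ½ xᵀ A_i x + a_iᵀ x`. -/
def quadMap {n m : ℕ} (A : Fin m → Matrix (Fin n) (Fin n) ℝ)
    (b : Fin m → EuclideanSpace ℝ (Fin n)) (x : EuclideanSpace ℝ (Fin n)) :
    EuclideanSpace ℝ (Fin m) :=
  WithLp.toLp 2 fun i => (1 / 2 : ℝ) * (x.ofLp ⬝ᵥ (A i *ᵥ x.ofLp)) + (b i).ofLp ⬝ᵥ x.ofLp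

/-- The `n × m` matrix `[a_1 … a_m]` with columns `a_i`. -/
def linearPart {n m : ℕ} (b : Fin m → EuclideanSpace ℝ (Fin n)) : Matrix (Fin n) (Fin m) ℝ :=
  Matrix.of fun j i => b i j

/-- `ν = σ_min([a_1 … a_m])`. -/
def nu {n m : ℕ} (b : Fin m → EuclideanSpace ℝ (Fin n)) : ℝ := sigmaMin (linearPart b)

/-- `L_new = √(λ_max(∑ A_iᵀ A_i))`. -/
def Lnew {n m : ℕ} (A : Fin m → Matrix (Fin n) (Fin n) ℝ) : ℝ :=
  √(lambdaMax (∑ i, (A i)ᵀ * A i))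

/-- `ε*_new = ν / (2 L_new)`, with values in `[0, ∞]`: it is `∞` if `L_new = 0 < ν`. -/
def epsStar {n m : ℕ} (A : Fin m → Matrix (Fin n) (Fin n) ℝ)
    (b : Fin m → EuclideanSpace ℝ (Fin n)) : ℝ≥0∞ :=
  ENNReal.ofReal (nu b) / ENNReal.ofReal (2 * Lnew A)

end QuadMap

end

open scoped InnerProductSpace

/-! The strong convexity of the ball outweighs the curvature of the map. For x₀ = s x + t y, the
point s f(x) + t f(y) misses f(x₀) by (st/2) β(x - y, x - y), where β is the bilinear part of f,
hence by at most (L/2) st‖x - y‖². Strong convexity gives st‖x - y‖² ≤ ε² - ‖x₀ - a‖², so the miss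
is at most Lερ with ρ = ε - ‖x₀ - a‖, and the ball of radius ρ about x₀ stays inside the given one.
There the adjoint derivative is bounded below by a constant above Lε, which is what the bound on ‖a‖
provides, so `exists_bilinQuad_eq` finds a preimage. `norm_quadBilin_le` and `nu_mul_norm_le` supply
L and ν from eigenvalues. -/

namespace QuadMap

/-! ### Quadratic maps between inner product spaces -/

section Abstract

variable {E F : Type*} [NormedAddCommGroup E] [InnerProductSpace ℝ E]
  [NormedAddCommGroup F] [InnerProductSpace ℝ F]

/-- The quadratic map `x ↦ ½ β(x, x) + D x`. -/
noncomputable def bilinQuad (β : E →ₗ[ℝ] E →ₗ[ℝ] F) (D : E →ₗ[ℝ] F) (x : E) : F := (1 / 2 : ℝ) • β x x + D x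

/-- The derivative of `bilinQuad β D` at `x`. -/
noncomputable def bilinQuadDeriv (β : E →ₗ[ℝ] E →ₗ[ℝ] F) (D : E →ₗ[ℝ] F) (x : E) : E →ₗ[ℝ] F :=
  (1 / 2 : ℝ) • (β x + β.flip x) + D

lemma bilinQuad_add_smul (β : E →ₗ[ℝ] E →ₗ[ℝ] F) (D : E →ₗ[ℝ] F) (x h : E) (t : ℝ) :
    bilinQuad β D (x + t • h) =
      bilinQuad β D x + t • bilinQuadDeriv β D x h + (t ^ 2 / 2) • β h h := by
  simp only [bilinQuad, bilinQuadDeriv, map_add, map_smul, LinearMap.add_apply,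
    LinearMap.smul_apply, LinearMap.flip_apply]
  module

lemma bilinQuad_convexCombo (β : E →ₗ[ℝ] E →ₗ[ℝ] F) (D : E →ₗ[ℝ] F) (x y : E) {s t : ℝ}
    (hst : s + t = 1) :
    s • bilinQuad β D x + t • bilinQuad β D y - bilinQuad β D (s • x + t • y) =
      (s * t / 2) • β (x - y) (x - y) := by
  obtain rfl : s = 1 - t := by linarith
  simp only [bilinQuad, map_add, map_sub, map_smul, LinearMap.add_apply, LinearMap.sub_apply,
    LinearMap.smul_apply]
  module

variable [FiniteDimensional ℝ E]

lemma continuous_bilinQuad (β : E →ₗ[ℝ] E →ₗ[ℝ] F) (D : E →ₗ[ℝ] F) :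
    Continuous (bilinQuad β D) := by
  have h : Continuous fun p : E × E => β p.1 p.2 := by
    have := β.toContinuousBilinearMap.continuous₂
    exact this
  exact ((h.comp (continuous_id.prodMk continuous_id)).const_smul _).add
    D.continuous_of_finiteDimensional

variable [FiniteDimensional ℝ F]

/-- If the adjoint of `T` is bounded below by `κ`, then every `w` has a preimage under `T` of norm
at most `‖w‖ / κ`. -/
lemma exists_preimage_norm_le (T : E →ₗ[ℝ] F) {κ : ℝ} (hκ : 0 < κ)
    (hT : ∀ y, κ * ‖y‖ ≤ ‖LinearMap.adjoint T y‖) (w : F) :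
    ∃ h, T h = w ∧ κ * ‖h‖ ≤ ‖w‖ := by
  -- In finite dimension T T* is bijective, so h = T* y with T T* y = w is a preimage.
  have hinj : Function.Injective (T ∘ₗ LinearMap.adjoint T) := by
    rw [← LinearMap.ker_eq_bot, LinearMap.ker_eq_bot']
    intro y hy
    have h1 : ⟪LinearMap.adjoint T y, LinearMap.adjoint T y⟫_ℝ = 0 := by
      rw [LinearMap.adjoint_inner_left, ← LinearMap.comp_apply, hy, inner_zero_right]
    have h2 := hT y
    rw [inner_self_eq_zero.1 h1, norm_zero] at h2
    exact norm_le_zero_iff.1 (nonpos_of_mul_nonpos_right h2 hκ)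
  obtain ⟨y, rfl⟩ := LinearMap.injective_iff_surjective.1 hinj w
  refine ⟨LinearMap.adjoint T y, rfl, ?_⟩
  set h := LinearMap.adjoint T y with hh
  rcases (norm_nonneg h).eq_or_lt with h0 | h0
  · simp [← h0]
  have h1 : ‖h‖ ^ 2 ≤ ‖y‖ * ‖T h‖ := by
    rw [← real_inner_self_eq_norm_sq]
    nth_rw 1 [hh]
    rw [LinearMap.adjoint_inner_left]
    exact real_inner_le_norm _ _
  have h2 := hT y
  rw [← hh] at h2
  show κ * ‖h‖ ≤ ‖T h‖
  refine le_of_mul_le_mul_right ?_ h0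
  calc κ * ‖h‖ * ‖h‖ = κ * ‖h‖ ^ 2 := by ring
    _ ≤ κ * (‖y‖ * ‖T h‖) := by gcongr
    _ = κ * ‖y‖ * ‖T h‖ := by ring
    _ ≤ ‖h‖ * ‖T h‖ := by gcongr
    _ = ‖T h‖ * ‖h‖ := by ring

/-- The adjoint of the derivative at `x` is bounded below by `ν - L ‖x‖`. -/
lemma le_norm_adjoint_bilinQuadDeriv (β : E →ₗ[ℝ] E →ₗ[ℝ] F) (D : E →ₗ[ℝ] F) {L ν : ℝ}
    (hL : 0 ≤ L) (hβ : ∀ x y, ‖β x y‖ ≤ L * ‖x‖ * ‖y‖)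
    (hD : ∀ y, ν * ‖y‖ ≤ ‖LinearMap.adjoint D y‖) (x : E) (y : F) :
    (ν - L * ‖x‖) * ‖y‖ ≤ ‖LinearMap.adjoint (bilinQuadDeriv β D x) y‖ := by
  set S : E →ₗ[ℝ] F := (1 / 2 : ℝ) • (β x + β.flip x) with hS
  have hSn : ∀ z, ‖S z‖ ≤ L * ‖x‖ * ‖z‖ := by
    intro z
    have h1 : S z = (1 / 2 : ℝ) • (β x z + β z x) := rfl
    rw [h1, norm_smul]
    have h2 := norm_add_le (β x z) (β z x)
    have h3 := hβ x z
    have h4 := hβ z x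
    norm_num
    nlinarith
  have hadj : ‖LinearMap.adjoint S y‖ ≤ L * ‖x‖ * ‖y‖ := by
    set u := LinearMap.adjoint S y with hu
    rcases (norm_nonneg u).eq_or_lt with h0 | h0
    · rw [← h0]; positivity
    refine le_of_mul_le_mul_right ?_ h0
    calc ‖u‖ * ‖u‖ = ⟪u, u⟫_ℝ := (real_inner_self_eq_norm_mul_norm u).symm
      _ = ⟪y, S u⟫_ℝ := by nth_rw 1 [hu]; rw [LinearMap.adjoint_inner_left]
      _ ≤ ‖y‖ * ‖S u‖ := real_inner_le_norm _ _
      _ ≤ ‖y‖ * (L * ‖x‖ * ‖u‖) := by gcongr; exact hSn u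
      _ = L * ‖x‖ * ‖y‖ * ‖u‖ := by ring
  have h1 : LinearMap.adjoint (bilinQuadDeriv β D x) y =
      LinearMap.adjoint D y + LinearMap.adjoint S y := by
    simp only [bilinQuadDeriv, map_add, LinearMap.add_apply, hS, add_comm]
  rw [h1]
  have h2 := norm_sub_le_norm_add (LinearMap.adjoint D y) (LinearMap.adjoint S y)
  have h3 := hD y
  linarith

/-- If the adjoint derivative is bounded below by `κ > c` on a closed ball of radius `ρ`, then the
image of the ball contains the closed ball of radius `c ρ` about the image of the centre. -/
lemma exists_bilinQuad_eq (β : E →ₗ[ℝ] E →ₗ[ℝ] F) (D : E →ₗ[ℝ] F) {c κ ρ : ℝ}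
    (hc : 0 < c) (hcκ : c < κ) (hρ : 0 ≤ ρ) (x₀ : E)
    (hT : ∀ x ∈ Metric.closedBall x₀ ρ, ∀ y,
      κ * ‖y‖ ≤ ‖LinearMap.adjoint (bilinQuadDeriv β D x) y‖)
    (y : F) (hy : ‖bilinQuad β D x₀ - y‖ ≤ c * ρ) :
    ∃ x ∈ Metric.closedBall x₀ ρ, bilinQuad β D x = y := by
  have hκ : 0 < κ := hc.trans hcκ
  -- Minimise the residual plus a penalty of slope c; a Newton step will contradict a nonzero
  -- residual.
  have hcont : Continuous fun x => ‖bilinQuad β D x - y‖ + c * ‖x - x₀‖ := by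
    have := continuous_bilinQuad β D
    fun_prop
  obtain ⟨x, hx, hmin⟩ := (isCompact_closedBall x₀ ρ).exists_isMinOn
    ⟨x₀, Metric.mem_closedBall_self hρ⟩ hcont.continuousOn
  refine ⟨x, hx, ?_⟩
  by_contra hne
  set r := ‖bilinQuad β D x - y‖ with hr
  have hr0 : 0 < r := norm_pos_iff.2 (sub_ne_zero.2 hne)
  -- Comparison with the centre: since r > 0, the minimiser is interior, which leaves room to move.
  have hx₀ : r + c * ‖x - x₀‖ ≤ c * ρ := by
    have := hmin (Metric.mem_closedBall_self hρ)
    simp only [Set.mem_ofPred_eq, sub_self, norm_zero, mul_zero, add_zero] at this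
    exact this.trans hy
  have hlt : ‖x - x₀‖ < ρ := lt_of_mul_lt_mul_left (by linarith) hc.le
  obtain ⟨h, hh, hhn⟩ := exists_preimage_norm_le _ hκ (hT x hx) (y - bilinQuad β D x)
  rw [norm_sub_rev, ← hr] at hhn
  -- To first order, moving by t h lowers the residual by t r and raises the penalty by at most t
  -- c‖h‖; c < κ makes this a net gain.
  have hgap : 0 < r - c * ‖h‖ := by
    rcases (norm_nonneg h).eq_or_lt with h0 | h0
    · rw [← h0]; simpa using hr0
    · nlinarith
  obtain ⟨t, ht0, ht1, htρ, htC⟩ : ∃ t : ℝ, 0 < t ∧ t ≤ 1 ∧ ‖x - x₀‖ + t * ‖h‖ ≤ ρ ∧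
      t * (‖β h h‖ / 2) < r - c * ‖h‖ := by
    have e1 : ∀ᶠ t : ℝ in nhdsWithin 0 (Set.Ioi 0), ‖x - x₀‖ + t * ‖h‖ < ρ := by
      refine nhdsWithin_le_nhds (ContinuousAt.eventually_lt (by fun_prop) continuousAt_const ?_)
      simpa using hlt
    have e2 : ∀ᶠ t : ℝ in nhdsWithin 0 (Set.Ioi 0), t * (‖β h h‖ / 2) < r - c * ‖h‖ := by
      refine nhdsWithin_le_nhds (ContinuousAt.eventually_lt (by fun_prop) continuousAt_const ?_)
      simpa using hgap
    have e3 : ∀ᶠ t : ℝ in nhdsWithin 0 (Set.Ioi 0), t < 1 :=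
      nhdsWithin_le_nhds (eventually_lt_nhds zero_lt_one)
    obtain ⟨t, h1, h2, h3, h4⟩ := (e1.and (e2.and (e3.and self_mem_nhdsWithin))).exists
    exact ⟨t, h4, h3.le, h1.le, h2⟩
  have hdist : ‖x + t • h - x₀‖ ≤ ‖x - x₀‖ + t * ‖h‖ := by
    rw [add_sub_right_comm]
    refine (norm_add_le _ _).trans_eq ?_
    rw [norm_smul, Real.norm_of_nonneg ht0.le]
  have hres : ‖bilinQuad β D (x + t • h) - y‖ ≤ (1 - t) * r + t ^ 2 / 2 * ‖β h h‖ := by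
    have : bilinQuad β D (x + t • h) - y =
        (1 - t) • (bilinQuad β D x - y) + (t ^ 2 / 2) • β h h := by
      rw [bilinQuad_add_smul, hh]; module
    rw [this]
    refine (norm_add_le _ _).trans_eq ?_
    rw [norm_smul, norm_smul, Real.norm_of_nonneg (sub_nonneg.2 ht1),
      Real.norm_of_nonneg (by positivity)]
  have hle := hmin (show x + t • h ∈ Metric.closedBall x₀ ρ by
    rw [mem_closedBall_iff_norm]; exact hdist.trans htρ)
  simp only [Set.mem_ofPred_eq, ← hr] at hle
  nlinarith [mul_le_mul_of_nonneg_left hdist hc.le, mul_lt_mul_of_pos_left htC ht0]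

/-- Images of small balls under a quadratic map that is sufficiently regular are convex. -/
theorem convex_image_bilinQuad (β : E →ₗ[ℝ] E →ₗ[ℝ] F) (D : E →ₗ[ℝ] F) {L ν ε : ℝ}
    (hL : 0 ≤ L) (hβ : ∀ x y, ‖β x y‖ ≤ L * ‖x‖ * ‖y‖)
    (hD : ∀ y, ν * ‖y‖ ≤ ‖LinearMap.adjoint D y‖) (hε : 0 < ε) (a : E)
    (hν : L * ‖a‖ + 2 * L * ε < ν) :
    Convex ℝ (bilinQuad β D '' Metric.closedBall a ε) := by
  rintro _ ⟨x, hx, rfl⟩ _ ⟨y, hy, rfl⟩ s t hs ht hst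
  rw [mem_closedBall_iff_norm] at hx hy
  set x₀ := s • x + t • y with hx₀
  set ρ := ε - ‖x₀ - a‖ with hρ
  have hsq : ‖x₀ - a‖ ^ 2 ≤ ε ^ 2 - s * t * ‖x - y‖ ^ 2 := by
    have e1 : x₀ - a = s • (x - a) + t • (y - a) := by
      obtain rfl : s = 1 - t := by linarith
      rw [hx₀]; module
    have e2 : x - y = (x - a) - (y - a) := by abel
    rw [e1, e2, norm_add_sq_real, norm_sub_sq_real, norm_smul, norm_smul, inner_smul_left,
      inner_smul_right, Real.norm_of_nonneg hs, Real.norm_of_nonneg ht]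
    simp only [conj_trivial]
    have h1 : ‖x - a‖ ^ 2 ≤ ε ^ 2 := by gcongr
    have h2 : ‖y - a‖ ^ 2 ≤ ε ^ 2 := by gcongr
    obtain rfl : s = 1 - t := by linarith
    nlinarith [mul_le_mul_of_nonneg_left h1 hs, mul_le_mul_of_nonneg_left h2 ht]
  have hst0 : 0 ≤ s * t := mul_nonneg hs ht
  have hx₀ε : ‖x₀ - a‖ ≤ ε := by
    refine le_of_sq_le_sq ?_ hε.le
    nlinarith [mul_nonneg hst0 (sq_nonneg ‖x - y‖)]
  have hsub : ∀ z ∈ Metric.closedBall x₀ ρ, z ∈ Metric.closedBall a ε :=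
    Metric.closedBall_subset_closedBall' (by rw [dist_eq_norm]; linarith)
  have hLε : 0 ≤ L * ε := mul_nonneg hL hε.le
  set κ := ν - L * (‖a‖ + ε) with hκ
  have hκL : L * ε < κ := by rw [hκ]; linarith
  -- A strict intermediate c keeps c > 0 even when L = 0.
  obtain ⟨c, hc1, hc2⟩ := exists_between hκL
  have hT : ∀ z ∈ Metric.closedBall x₀ ρ, ∀ w,
      κ * ‖w‖ ≤ ‖LinearMap.adjoint (bilinQuadDeriv β D z) w‖ := by
    intro z hz w
    refine le_trans ?_ (le_norm_adjoint_bilinQuadDeriv β D hL hβ hD z w)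
    have h1 := mem_closedBall_iff_norm.1 (hsub z hz)
    have h2 : ‖z‖ ≤ ‖a‖ + ε := by linarith [norm_le_norm_add_norm_sub' z a]
    rw [hκ]
    gcongr
  have hρ0 : 0 ≤ ρ := sub_nonneg.2 hx₀ε
  obtain ⟨z, hz, hz'⟩ := exists_bilinQuad_eq β D (hLε.trans_lt hc1) hc2 hρ0 x₀ hT
    (s • bilinQuad β D x + t • bilinQuad β D y) (by
      rw [norm_sub_rev, hx₀, bilinQuad_convexCombo β D x y hst, norm_smul,
        Real.norm_of_nonneg (by positivity)]
      have h1 := hβ (x - y) (x - y)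
      -- Factor ε² - ‖x₀ - a‖² = ρ (ε + ‖x₀ - a‖), whose second factor is at most 2ε.
      have h2 : s * t * ‖x - y‖ ^ 2 ≤ 2 * ε * ρ := by
        nlinarith [norm_nonneg (x₀ - a)]
      calc s * t / 2 * ‖β (x - y) (x - y)‖
          ≤ s * t / 2 * (L * ‖x - y‖ * ‖x - y‖) := by gcongr
        _ = L / 2 * (s * t * ‖x - y‖ ^ 2) := by ring
        _ ≤ L / 2 * (2 * ε * ρ) := by gcongr
        _ = L * ε * ρ := by ring
        _ ≤ c * ρ := by gcongr)
  exact ⟨z, hsub z hz, hz'⟩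

end Abstract

/-! ### Rayleigh quotient bounds -/

section Spectrum

variable {k : ℕ} {M : Matrix (Fin k) (Fin k) ℝ}

lemma posSemidef_of_spectrum_nonneg (hM : M.IsHermitian) (h : ∀ r ∈ spectrum ℝ M, 0 ≤ r) :
    M.PosSemidef :=
  hM.posSemidef_iff_eigenvalues_nonneg.2 fun i => h _ (hM.eigenvalues_mem_spectrum_real i)

/-- Subtracting the smallest eigenvalue shifts the spectrum into [0, ∞). -/
lemma lambdaMin_mul_le (hM : M.IsHermitian) (v : Fin k → ℝ) :
    lambdaMin M * (v ⬝ᵥ v) ≤ v ⬝ᵥ (M *ᵥ v) := by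
  have hpos : (M - algebraMap ℝ _ (lambdaMin M)).PosSemidef := by
    refine posSemidef_of_spectrum_nonneg ?_ fun r hr => ?_
    · refine hM.sub ?_
      rw [Algebra.algebraMap_eq_smul_one]
      exact Matrix.isHermitian_one.smul (IsSelfAdjoint.all _)
    · rw [← spectrum.sub_singleton_eq] at hr
      obtain ⟨s, hs, _, rfl, rfl⟩ := hr
      exact sub_nonneg.2 (csInf_le M.finite_real_spectrum.bddBelow hs)
  have h := hpos.dotProduct_mulVec_nonneg v
  rw [Algebra.algebraMap_eq_smul_one, Matrix.sub_mulVec, Matrix.smul_mulVec, Matrix.one_mulVec,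
    star_trivial, dotProduct_sub, dotProduct_smul, smul_eq_mul] at h
  linarith

lemma le_lambdaMax_mul (hM : M.IsHermitian) (v : Fin k → ℝ) :
    v ⬝ᵥ (M *ᵥ v) ≤ lambdaMax M * (v ⬝ᵥ v) := by
  have hpos : (algebraMap ℝ _ (lambdaMax M) - M).PosSemidef := by
    refine posSemidef_of_spectrum_nonneg ?_ fun r hr => ?_
    · refine Matrix.IsHermitian.sub ?_ hM
      rw [Algebra.algebraMap_eq_smul_one]
      exact Matrix.isHermitian_one.smul (IsSelfAdjoint.all _)
    · rw [← spectrum.singleton_sub_eq] at hr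
      obtain ⟨_, rfl, s, hs, rfl⟩ := hr
      exact sub_nonneg.2 (le_csSup M.finite_real_spectrum.bddAbove hs)
  have h := hpos.dotProduct_mulVec_nonneg v
  rw [Algebra.algebraMap_eq_smul_one, Matrix.sub_mulVec, Matrix.smul_mulVec, Matrix.one_mulVec,
    star_trivial, dotProduct_sub, dotProduct_smul, smul_eq_mul] at h
  linarith

end Spectrum

/-! ### The constants of the concrete map -/

section Euclidean

variable {n m : ℕ}

lemma norm_sq_eq_dotProduct (x : EuclideanSpace ℝ (Fin n)) : ‖x‖ ^ 2 = x.ofLp ⬝ᵥ x.ofLp := by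
  rw [EuclideanSpace.real_norm_sq_eq, dotProduct]
  simp only [sq]

/-- The bilinear map `(x, y) ↦ (xᵀ A_i y)_i`. -/
noncomputable def quadBilin (A : Fin m → Matrix (Fin n) (Fin n) ℝ) :
    EuclideanSpace ℝ (Fin n) →ₗ[ℝ] EuclideanSpace ℝ (Fin n) →ₗ[ℝ] EuclideanSpace ℝ (Fin m) :=
  LinearMap.mk₂ ℝ (fun x y => WithLp.toLp 2 fun i => x.ofLp ⬝ᵥ (A i *ᵥ y.ofLp))
    (fun x x' y => by ext i; simp [add_dotProduct])
    (fun c x y => by ext i; simp)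
    (fun x y y' => by ext i; simp [Matrix.mulVec_add, dotProduct_add])
    (fun c x y => by ext i; simp [Matrix.mulVec_smul])

lemma quadMap_eq_bilinQuad (A : Fin m → Matrix (Fin n) (Fin n) ℝ)
    (b : Fin m → EuclideanSpace ℝ (Fin n)) :
    quadMap A b = bilinQuad (quadBilin A) (Matrix.toEuclideanLin (linearPart b)ᵀ) := by
  funext x
  ext i
  rfl

lemma dotProduct_transpose_mul_mulVec {k l : ℕ} (B : Matrix (Fin k) (Fin l) ℝ) (v : Fin l → ℝ) :
    v ⬝ᵥ ((Bᵀ * B) *ᵥ v) = (B *ᵥ v) ⬝ᵥ (B *ᵥ v) := by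
  rw [← Matrix.mulVec_mulVec, Matrix.dotProduct_mulVec, Matrix.vecMul_transpose]

lemma isHermitian_transpose_mul {k l : ℕ} (B : Matrix (Fin k) (Fin l) ℝ) :
    (Bᵀ * B).IsHermitian := by
  simpa using Matrix.isHermitian_conjTranspose_mul_self B

lemma nu_mul_norm_le (b : Fin m → EuclideanSpace ℝ (Fin n)) (y : EuclideanSpace ℝ (Fin m)) :
    nu b * ‖y‖ ≤ ‖LinearMap.adjoint (Matrix.toEuclideanLin (linearPart b)ᵀ) y‖ := by
  set B := linearPart b
  have hadj : LinearMap.adjoint (Matrix.toEuclideanLin Bᵀ) = Matrix.toEuclideanLin B := by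
    rw [← Matrix.toEuclideanLin_conjTranspose_eq_adjoint,
      Matrix.conjTranspose_eq_transpose_of_trivial,
      Matrix.transpose_transpose]
  rw [hadj]
  rcases le_or_gt (lambdaMin (Bᵀ * B)) 0 with h | h
  · have : nu b = 0 := Real.sqrt_eq_zero_of_nonpos h
    rw [this, zero_mul]
    exact norm_nonneg _
  · refine le_of_sq_le_sq ?_ (norm_nonneg _)
    have hν : nu b ^ 2 = lambdaMin (Bᵀ * B) := Real.sq_sqrt h.le
    rw [mul_pow, hν, norm_sq_eq_dotProduct, norm_sq_eq_dotProduct]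
    exact (lambdaMin_mul_le (isHermitian_transpose_mul B) y.ofLp).trans_eq
      (dotProduct_transpose_mul_mulVec B y.ofLp)

/-- Cauchy–Schwarz in each coordinate, summed: ∑ ‖A_i y‖² is the quadratic form of ∑ A_iᵀ A_i. -/
lemma norm_quadBilin_le (A : Fin m → Matrix (Fin n) (Fin n) ℝ) (x y : EuclideanSpace ℝ (Fin n)) :
    ‖quadBilin A x y‖ ≤ Lnew A * ‖x‖ * ‖y‖ := by
  have hL : lambdaMax (∑ i, (A i)ᵀ * A i) ≤ Lnew A ^ 2 :=
    (Real.sqrt_le_left (Real.sqrt_nonneg _)).1 le_rfl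
  have hL0 : 0 ≤ Lnew A := Real.sqrt_nonneg _
  have hM : (∑ i, (A i)ᵀ * A i).IsHermitian := by
    rw [Matrix.IsHermitian, Matrix.conjTranspose_sum]
    exact Finset.sum_congr rfl fun i _ => isHermitian_transpose_mul (A i)
  refine le_of_sq_le_sq ?_ (by positivity)
  have hsum : ∑ i, ‖WithLp.toLp 2 (A i *ᵥ y.ofLp)‖ ^ 2 ≤ Lnew A ^ 2 * ‖y‖ ^ 2 := by
    calc ∑ i, ‖WithLp.toLp 2 (A i *ᵥ y.ofLp)‖ ^ 2
        = y.ofLp ⬝ᵥ ((∑ i, (A i)ᵀ * A i) *ᵥ y.ofLp) := by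
          rw [Matrix.sum_mulVec, dotProduct_sum]
          refine Finset.sum_congr rfl fun i _ => ?_
          rw [norm_sq_eq_dotProduct, dotProduct_transpose_mul_mulVec]
      _ ≤ lambdaMax (∑ i, (A i)ᵀ * A i) * (y.ofLp ⬝ᵥ y.ofLp) :=
          le_lambdaMax_mul hM _
      _ ≤ Lnew A ^ 2 * ‖y‖ ^ 2 := by
          rw [← norm_sq_eq_dotProduct]
          gcongr
  calc ‖quadBilin A x y‖ ^ 2
      = ∑ i, ⟪WithLp.toLp 2 (A i *ᵥ y.ofLp), x⟫_ℝ ^ 2 := by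
        rw [EuclideanSpace.real_norm_sq_eq]
        rfl
    _ ≤ ∑ i, ‖x‖ ^ 2 * ‖WithLp.toLp 2 (A i *ᵥ y.ofLp)‖ ^ 2 := by
        refine Finset.sum_le_sum fun i _ => ?_
        rw [← mul_pow, mul_comm ‖x‖, sq_le_sq, abs_of_nonneg (a := ‖_‖ * ‖x‖) (by positivity)]
        exact abs_real_inner_le_norm _ _
    _ = ‖x‖ ^ 2 * ∑ i, ‖WithLp.toLp 2 (A i *ᵥ y.ofLp)‖ ^ 2 := by rw [Finset.mul_sum]
    _ ≤ ‖x‖ ^ 2 * (Lnew A ^ 2 * ‖y‖ ^ 2) := by gcongr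
    _ = (Lnew A * ‖x‖ * ‖y‖) ^ 2 := by ring

lemma Lnew_mul_lt_nu (A : Fin m → Matrix (Fin n) (Fin n) ℝ) (b : Fin m → EuclideanSpace ℝ (Fin n))
    {ε r : ℝ} (hε : 0 ≤ ε) (hr : 0 ≤ r) (hε' : ENNReal.ofReal ε < epsStar A b)
    (h : ENNReal.ofReal r < 2 * (epsStar A b - ENNReal.ofReal ε)) :
    Lnew A * r + 2 * Lnew A * ε < nu b := by
  have hL0 : 0 ≤ Lnew A := Real.sqrt_nonneg _
  -- As 0 / 0 = 0 in `ℝ≥0∞`, a positive threshold forces ν > 0; this settles the case L = 0.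
  have hν : 0 < nu b := by
    by_contra hneg
    rw [epsStar, ENNReal.ofReal_eq_zero.2 (not_lt.1 hneg), ENNReal.zero_div] at hε'
    exact not_lt_zero hε'
  rcases hL0.eq_or_lt with h0 | h0
  · rw [← h0]; simpa using hν
  · have he : epsStar A b = ENNReal.ofReal (nu b / (2 * Lnew A)) := by
      rw [epsStar, ENNReal.ofReal_div_of_pos (by positivity)]
    rw [he, ← ENNReal.ofReal_sub _ hε, ← ENNReal.ofReal_ofNat 2,
      ← ENNReal.ofReal_mul (by norm_num), ENNReal.ofReal_lt_ofReal_iff_of_nonneg hr] at h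
    have e : nu b = nu b / (2 * Lnew A) * (2 * Lnew A) := by field_simp
    rw [e]
    nlinarith

end Euclidean

end QuadMap

theorem theorem3 {n m : ℕ} (A : Fin m → Matrix (Fin n) (Fin n) ℝ)
    (b : Fin m → EuclideanSpace ℝ (Fin n)) (ε : ℝ) (hε : 0 < ε)
    (hε' : ENNReal.ofReal ε < QuadMap.epsStar A b)
    (a : EuclideanSpace ℝ (Fin n))
    (ha : ENNReal.ofReal ‖a‖ < 2 * (QuadMap.epsStar A b - ENNReal.ofReal ε)) :
    Convex ℝ {y : EuclideanSpace ℝ (Fin m) |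
      ∃ x : EuclideanSpace ℝ (Fin n), ‖x - a‖ ≤ ε ∧ QuadMap.quadMap A b x = y} := by
  have key := QuadMap.convex_image_bilinQuad (QuadMap.quadBilin A)
    (Matrix.toEuclideanLin (QuadMap.linearPart b)ᵀ) (Real.sqrt_nonneg _)
    (QuadMap.norm_quadBilin_le A) (QuadMap.nu_mul_norm_le b) hε a
    (QuadMap.Lnew_mul_lt_nu A b hε.le (norm_nonneg a) hε' ha)
  rw [← QuadMap.quadMap_eq_bilinQuad] at key
  have himage : {y : EuclideanSpace ℝ (Fin m) |
      ∃ x : EuclideanSpace ℝ (Fin n), ‖x - a‖ ≤ ε ∧ QuadMap.quadMap A b x = y} =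
      QuadMap.quadMap A b '' Metric.closedBall a ε := by
    ext y
    simp only [Set.mem_ofPred_eq, Set.mem_image, mem_closedBall_iff_norm]
  rwa [himage]
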